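/- Let $\boldsymbol{A}\in\mathbb{R}^{m\times n}$, $\boldsymbol{b}\in\mathbb{R}^m$, $\Omega^\circ=\{\boldsymbol{x}\in\mathbb{R}^n:\boldsymbol{A}\boldsymbol{x}=\boldsymbol{b},\ \boldsymbol{x}>\boldsymbol{0}\}$, and let $\boldsymbol{e}$ be the all-ones vector; for a vector $\boldsymbol{x}$ write $\boldsymbol{X}=\mathrm{diag}(\boldsymbol{x})$. Let $f:\mathbb{R}^n\to\mathbb{R}$ be differentiable on the positive orthant and twice differentiable at every point of $\Omega^\circ$. Suppose that there are constants $0<\gamma<1$, $l$ and $\rho>0$ such that for every $\boldsymbol{x}\in\Omega^\circ$ and all $\boldsymbol{d},\boldsymbol{d}'\in\ker(\boldsymbol{A}\boldsymbol{X})$ with $\|\boldsymbol{d}\|,\|\boldsymbol{d}'\|\le\gamma$, $$\|\boldsymbol{X}(\nabla f(\boldsymbol{X}(\boldsymbol{e}+\boldsymbol{d}))-\nabla f(\boldsymbol{X}(\boldsymbol{e}+\boldsymbol{d}')))\|\le l\|\boldsymbol{d}-\boldsymbol{d}'\|,$$ $$\|\boldsymbol{X}(\nabla^2 f(\boldsymbol{X}(\boldsymbol{e}+\boldsymbol{d}))-\nabla^2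 f(\boldsymbol{X}(\boldsymbol{e}+\boldsymbol{d}')))\boldsymbol{X}\|\le \rho\|\boldsymbol{d}-\boldsymbol{d}'\|$$ (Euclidean norm for vectors, spectral norm for matrices). Let $\boldsymbol{x}\in\Omega^\circ$, $\varepsilon>0$, $\delta_0\in(0,1)$, let $\boldsymbol{P}$ be the orthogonal projector onto $\ker(\boldsymbol{A}\boldsymbol{X})$, $k=\dim\ker(\boldsymbol{A}\boldsymbol{X})$, and suppose that the minimum eigenvalue of $\boldsymbol{X}\nabla^2 f(\boldsymbol{x})\boldsymbol{X}$ restricted to $\ker(\boldsymbol{A}\boldsymbol{X})$ (i.e. of $\boldsymbol{P}\boldsymbol{X}\nabla^2 f(\boldsymbol{x})\boldsymbol{X}$ as an operator on $\ker(\boldsymbol{A}\boldsymbol{X})$) is smaller than $-\sqrt{\varepsilon}$. Put $$\mathcal{T}=\left\lceil\frac{8l}{\sqrt{\varepsilon}}\log\left(\frac{8l}{\delta_0}\sqrt{\frac{n}{\pi\varepsilon}}\right)\right\rceil,\qquad r=\frac{1}{8\rho}\left(\frac{1+\frac{7\sqrt{\varepsilon}}{8l}}{2}\right)^{\mathcal{T}}\sqrt{\frac{\pi\varepsilon}{k}}\,\delta_0,$$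 and suppose that $r\le\gamma$. Let $\boldsymbol{y}_0$ be uniformly distributed on the ball of radius $r$ centred at the origin of $\ker(\boldsymbol{A}\boldsymbol{X})$, and for $t=0,\dots,\mathcal{T}-1$ let $$\boldsymbol{y}_{t+1}=\boldsymbol{y}_t-\frac{\|\boldsymbol{y}_t\|}{lr}\boldsymbol{P}\boldsymbol{X}\left(\nabla f\left(\boldsymbol{X}\left(\boldsymbol{e}+\frac{r\boldsymbol{y}_t}{\|\boldsymbol{y}_t\|}\right)\right)-\nabla f(\boldsymbol{x})\right).$$ Then, with probability at least $1-\delta_0$, the output $\widehat{\boldsymbol{e}}=\boldsymbol{y}_{\mathcal{T}}/\|\boldsymbol{y}_{\mathcal{T}}\|$ is well defined and is a unit vector with $\boldsymbol{A}\boldsymbol{X}\widehat{\boldsymbol{e}}=\boldsymbol{0}$ and $\widehat{\boldsymbol{e}}^\top\boldsymbol{X}\nabla^2 f(\boldsymbol{x})\boldsymbol{X}\widehat{\boldsymbol{e}}\le-\sqrt{\varepsilon}/4$. -/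

import Mathlib

open MeasureTheory

noncomputable section

namespace IPTR

variable {m n : ℕ}

/-- The strictly positive orthant of `ℝⁿ`. -/
def posOrthant (n : ℕ) : Set (EuclideanSpace ℝ (Fin n)) := {x | ∀ i, 0 < x i}

/-- The set `Ω° = {x : A x = b, x > 0}` of strictly feasible points. -/
def strictInterior (A : Matrix (Fin m) (Fin n) ℝ) (b : Fin m → ℝ) :
    Set (EuclideanSpace ℝ (Fin n)) :=
  {x | A.mulVec x.ofLp = b ∧ ∀ i, 0 < x i}

/-- The operator `X = diag(x)` on Euclidean space. -/
def scaling (x : EuclideanSpace ℝ (Fin n)) :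
    EuclideanSpace ℝ (Fin n) →L[ℝ] EuclideanSpace ℝ (Fin n) :=
  Matrix.toEuclideanCLM (n := Fin n) (𝕜 := ℝ) (Matrix.diagonal x.ofLp)

/-- The all-ones vector `e`. -/
def ones (n : ℕ) : EuclideanSpace ℝ (Fin n) := WithLp.toLp 2 (fun _ => 1)

/-- The Hessian `∇²f(x)`, the derivative of the gradient, as an operator. -/
def hessian (f : EuclideanSpace ℝ (Fin n) → ℝ) (x : EuclideanSpace ℝ (Fin n)) :
    EuclideanSpace ℝ (Fin n) →L[ℝ] EuclideanSpace ℝ (Fin n) :=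
  fderiv ℝ (gradient f) x

/-- The scaled Hessian `X ∇²f(z) X` with `X = diag(x)`. -/
def scaledHessian (f : EuclideanSpace ℝ (Fin n) → ℝ) (x z : EuclideanSpace ℝ (Fin n)) :
    EuclideanSpace ℝ (Fin n) →L[ℝ] EuclideanSpace ℝ (Fin n) :=
  scaling x ∘L hessian f z ∘L scaling x

/-- The subspace `ker(AX)`, where `X = diag(x)`. -/
def kerAX (A : Matrix (Fin m) (Fin n) ℝ) (x : EuclideanSpace ℝ (Fin n)) :
    Submodule ℝ (EuclideanSpace ℝ (Fin n)) :=
  LinearMap.ker (Matrix.toEuclideanLin (A * Matrix.diagonal x.ofLp))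

/-- `f` is differentiable on the positive orthant and twice differentiable at every point
of `Ω°`. -/
structure TwiceDifferentiableOnInterior (A : Matrix (Fin m) (Fin n) ℝ) (b : Fin m → ℝ)
    (f : EuclideanSpace ℝ (Fin n) → ℝ) : Prop where
  differentiableOn : DifferentiableOn ℝ f (posOrthant n)
  differentiableAt_gradient : ∀ x ∈ strictInterior A b, DifferentiableAt ℝ (gradient f) x

/-- Scaled Lipschitz continuity of the gradient, with constants `γ` and `l`. -/
structure ScaledGradientLipschitz (A : Matrix (Fin m) (Fin n) ℝ) (b : Fin m → ℝ)
    (f : EuclideanSpace ℝ (Fin n) → ℝ) (γ l : ℝ) : Prop where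
  twiceDifferentiable : TwiceDifferentiableOnInterior A b f
  bound : ∀ x ∈ strictInterior A b, ∀ d ∈ kerAX A x, ∀ d' ∈ kerAX A x, ‖d‖ ≤ γ → ‖d'‖ ≤ γ →
    ‖scaling x (gradient f (scaling x (ones n + d)) - gradient f (scaling x (ones n + d')))‖
      ≤ l * ‖d - d'‖

/-- Scaled Lipschitz continuity of the Hessian (in operator norm), with constants `γ`
and `ρ`. -/
structure ScaledHessianLipschitz (A : Matrix (Fin m) (Fin n) ℝ) (b : Fin m → ℝ)
    (f : EuclideanSpace ℝ (Fin n) → ℝ) (γ ρ : ℝ) : Prop where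
  twiceDifferentiable : TwiceDifferentiableOnInterior A b f
  bound : ∀ x ∈ strictInterior A b, ∀ d ∈ kerAX A x, ∀ d' ∈ kerAX A x, ‖d‖ ≤ γ → ‖d'‖ ≤ γ →
    ‖scaling x ∘L (hessian f (scaling x (ones n + d)) - hessian f (scaling x (ones n + d')))
        ∘L scaling x‖ ≤ ρ * ‖d - d'‖

/-- The restriction to the subspace `K` of the quadratic form of `M`: the operator `P M` on
`K`, with `P` the orthogonal projection onto `K`. -/
def compression (K : Submodule ℝ (EuclideanSpace ℝ (Fin n)))
    (M : EuclideanSpace ℝ (Fin n) →L[ℝ] EuclideanSpace ℝ (Fin n)) : K →L[ℝ] K :=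
  K.orthogonalProjectionOnto ∘L M ∘L K.subtypeL

/-- The minimum eigenvalue of `M` restricted to `K` (equal to `0` if `K` is trivial). -/
def minEigenvalueOn (K : Submodule ℝ (EuclideanSpace ℝ (Fin n)))
    (M : EuclideanSpace ℝ (Fin n) →L[ℝ] EuclideanSpace ℝ (Fin n)) : ℝ :=
  sInf {μ : ℝ | Module.End.HasEigenvalue (compression K M).toLinearMap μ}

/-- One step of the projected finite-difference power iteration,
`y ↦ y - ‖y‖/(l r) · P X (∇f(X(e + r y/‖y‖)) - ∇f(x))`, with `P` the orthogonal projection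
onto `ker(AX)`. -/
def powerStep (A : Matrix (Fin m) (Fin n) ℝ) (f : EuclideanSpace ℝ (Fin n) → ℝ)
    (x : EuclideanSpace ℝ (Fin n)) (l r : ℝ) (y : EuclideanSpace ℝ (Fin n)) :
    EuclideanSpace ℝ (Fin n) :=
  y - (‖y‖ / (l * r)) • (kerAX A x).starProjection
    (scaling x (gradient f (scaling x (ones n + (r / ‖y‖) • y)) - gradient f x))

/-- The iterate `y_t` of the power iteration started at `y₀`. -/
def powerIterate (A : Matrix (Fin m) (Fin n) ℝ) (f : EuclideanSpace ℝ (Fin n) → ℝ)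
    (x : EuclideanSpace ℝ (Fin n)) (l r : ℝ) (y₀ : EuclideanSpace ℝ (Fin n)) :
    ℕ → EuclideanSpace ℝ (Fin n)
  | 0 => y₀
  | t + 1 => powerStep A f x l r (powerIterate A f x l r y₀ t)

/-- The output of the negative curvature procedure after `T` steps from `y₀`: the last
iterate, normalized. -/
def negCurvatureOutput (A : Matrix (Fin m) (Fin n) ℝ) (f : EuclideanSpace ℝ (Fin n) → ℝ)
    (x : EuclideanSpace ℝ (Fin n)) (l r : ℝ) (T : ℕ) (y₀ : EuclideanSpace ℝ (Fin n)) :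
    EuclideanSpace ℝ (Fin n) :=
  ‖powerIterate A f x l r y₀ T‖⁻¹ • powerIterate A f x l r y₀ T

/-- The uniform distribution on the ball of radius `r` centred at the origin of the subspace
`K` (with respect to Lebesgue measure on `K`). -/
def uniformBall (K : Submodule ℝ (EuclideanSpace ℝ (Fin n))) (r : ℝ) : Measure K :=
  ProbabilityTheory.cond volume (Metric.closedBall (0 : K) r)

/-- The number of steps `8l/√ε · log((8l/δ₀) √(n/(π ε)))`, rounded up. -/
def numSteps (n : ℕ) (l ε δ₀ : ℝ) : ℕ :=
  ⌈8 * l / √ε * Real.log (8 * l / δ₀ * √(n / (Real.pi * ε)))⌉₊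

/-- The radius `((1 + 7√ε/(8l))/2)^T / (8ρ) · √(π ε / k) · δ₀`. -/
def radius (k T : ℕ) (l ρ ε δ₀ : ℝ) : ℝ :=
  ((1 + 7 * √ε / (8 * l)) / 2) ^ T / (8 * ρ) * √(Real.pi * ε / k) * δ₀

end IPTR

end

/-!
Write `K = ker(AX)`, `s = √ε / l` and let `H` be the compression of `X ∇²f(x) X` to `K`, which is
symmetric because `f` is twice differentiable at `x` (`isSymmetric_compression_scaledHessian`). The
gradient condition gives `‖H‖ ≤ l` (`norm_compression_scaledHessian_le`), so the existence of an
eigenvalue below `-√ε` forces `0 < s < 1`. The Hessian condition gives the Taylor bound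
`‖F d - H d‖ ≤ ρ ‖d‖² / 2` for the projected gradient difference `F`
(`norm_scaledGradient_sub_compression_le`). Hence the procedure is a power iteration for
`M = 1 - H / l`, whose spectrum lies in `[0, 2]`, with a relative error of at most `ρ r / (2 l)` per
step, and each step at most doubles the norm.

Let `u` be a unit eigenvector of `H` with eigenvalue below `-√ε`. The slab on which
`|⟪u, y₀⟫| ≤ β r`, with `β = δ₀ √(π / k) / 2`, occupies at most the fraction `δ₀` of the ball: it is
contained in a cylinder, and the ratio of the volumes of unit balls in consecutive dimensions is
controlled by log-convexity of the Gamma function (`volume_slab_le_mul_volume_closedBall`). Outside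
the slab the component of `M ^ T y₀` along `u` is at least `(1 + s) ^ T β r`. Two quantities are
small compared to it: the accumulated errors, at most `T 2 ^ (T - 1) ρ r² / (2 l)`
(`accumulated_error_le`), and the part of `M ^ T y₀` in the eigenspaces with eigenvalue above
`-√ε / 4`, at most `(1 + s / 4) ^ T r` (`subdominant_growth_numSteps_le`).

In an orthonormal eigenbasis, the form `⟪y, (H + √ε / 4) y⟫` has positive terms only in those
eigenspaces, while the `u`-term is at most `-(3 / 4) √ε ⟪u, y⟫²`. The latter wins, so the form is
nonpositive at the last iterate (`rayleigh_le_of_powerIteration`). The eigendirections in between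
contribute with the right sign and need no estimate.
-/

namespace IPTR

/-! ### Numerical estimates -/

/-- The bound `log (1 + x) ≥ 2x / (x + 2)`, in the form in which it is used here. -/
lemma inv_one_add_pow_le_exp {x : ℝ} (hx : 0 ≤ x) (T : ℕ) :
    ((1 + x)⁻¹) ^ T ≤ Real.exp (-(T * (2 * x / (x + 2)))) := by
  have h1 : (0 : ℝ) < 1 + x := by linarith
  have h := Real.le_log_one_add_of_nonneg hx
  have h2 : (1 + x)⁻¹ = Real.exp (-Real.log (1 + x)) := by
    rw [Real.exp_neg, Real.exp_log h1]
  rw [h2, ← Real.exp_nat_mul]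
  apply Real.exp_le_exp.mpr
  nlinarith [mul_le_mul_of_nonneg_left h (Nat.cast_nonneg (α := ℝ) T)]

/-- The accumulated linearization error relative to the growth of the most negative
eigendirection. With `a = 2 / (16 + 15 s)` the left-hand side is at most `(T s / 16) exp (-a T s)`.
If `s` is close to `1`, the maximum `1 / (a e)` of `u ↦ u exp (-a u)` is small enough; if `s` is
small, the lower bound on `T` supplies the factor `√s`. -/
lemma relative_error_le {s : ℝ} {T : ℕ} (hs : 0 < s) (hs1 : s < 1)
    (hT : 8 * Real.log (9 / 2 / s) ≤ T * s) :
    T * s / 16 * ((1 + 7 * s / 8) / (1 + s)) ^ T ≤ 21 / 50 * √s := by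
  have hq : 0 < √s := Real.sqrt_pos.mpr hs
  have hqq : √s * √s = s := Real.mul_self_sqrt hs.le
  have hq1 : √s ≤ 1 := by nlinarith
  have he : (2.718 : ℝ) < Real.exp 1 := by linarith [Real.exp_one_gt_d9]
  set U : ℝ := T * s with hU
  have hU0 : 0 ≤ U := by positivity
  have hpow : ((1 + 7 * s / 8) / (1 + s)) ^ T ≤ Real.exp (-(2 / (16 + 15 * s) * U)) := by
    have h := inv_one_add_pow_le_exp (x := s / (8 + 7 * s)) (by positivity) T
    have e1 : (1 + s / (8 + 7 * s))⁻¹ = (1 + 7 * s / 8) / (1 + s) := by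
      field_simp
      ring
    have e2 : (T : ℝ) * (2 * (s / (8 + 7 * s)) / (s / (8 + 7 * s) + 2))
        = 2 / (16 + 15 * s) * U := by
      have : s / (8 + 7 * s) + 2 = (16 + 15 * s) / (8 + 7 * s) := by
        field_simp
        ring
      rw [this, hU]
      field_simp
    rwa [e1, e2] at h
  -- the tangent bound `u ≤ u₀ exp (u / u₀ - 1)`
  have htan : ∀ u₀ : ℝ, 0 < u₀ → U ≤ u₀ * Real.exp (U / u₀ - 1) := by
    intro u₀ hu
    have h := Real.add_one_le_exp (U / u₀ - 1)
    have h2 := mul_le_mul_of_nonneg_left h hu.le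
    have e1 : u₀ * (U / u₀ - 1 + 1) = U := by
      field_simp
      ring
    linarith
  have hmain : ∀ u₀ : ℝ, 0 < u₀ → U / 16 * ((1 + 7 * s / 8) / (1 + s)) ^ T
      ≤ u₀ / 16 / Real.exp 1 * Real.exp (-((2 / (16 + 15 * s) - 1 / u₀) * U)) := by
    intro u₀ hu
    calc U / 16 * ((1 + 7 * s / 8) / (1 + s)) ^ T
        ≤ (u₀ * Real.exp (U / u₀ - 1)) / 16 * Real.exp (-(2 / (16 + 15 * s) * U)) := by
          gcongr
          exact htan u₀ hu
      _ = u₀ / 16 * (Real.exp (U / u₀ - 1) * Real.exp (-(2 / (16 + 15 * s) * U))) := by ring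
      _ = u₀ / 16 * (Real.exp (-1) * Real.exp (-((2 / (16 + 15 * s) - 1 / u₀) * U))) := by
          rw [← Real.exp_add, ← Real.exp_add]
          congr 2
          ring
      _ = _ := by rw [Real.exp_neg 1]; ring
  rcases le_total (2 / 5) s with h | h
  · refine (hmain ((16 + 15 * s) / 2) (by positivity)).trans ?_
    have e1 : 2 / (16 + 15 * s) - 1 / ((16 + 15 * s) / 2) = 0 := by
      field_simp
      ring
    rw [e1, zero_mul, neg_zero, Real.exp_zero, mul_one, div_le_iff₀ (by positivity)]
    have hq2 : (0.632 : ℝ) ≤ √s := Real.le_sqrt_of_sq_le (by norm_num; linarith)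
    have h3 : 21 / 50 * √s * 2.718 ≤ 21 / 50 * √s * Real.exp 1 := by gcongr
    nlinarith [mul_nonneg (sub_nonneg.mpr hq2) (sub_nonneg.mpr hq1)]
  · have h16 : 0 < 16 - 15 * s := by linarith
    refine (hmain (16 * (16 + 15 * s) / (16 - 15 * s)) (by positivity)).trans ?_
    have e1 : 2 / (16 + 15 * s) - 1 / (16 * (16 + 15 * s) / (16 - 15 * s)) = 1 / 16 := by
      field_simp
      ring
    rw [e1]
    have h2 : Real.exp (-(1 / 16 * U)) ≤ √s / 2.12 := by
      rw [le_div_iff₀ (by norm_num), ← Real.log_le_log_iff (by positivity) hq,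
        Real.log_mul (by positivity) (by norm_num), Real.log_exp, Real.log_sqrt hs.le]
      rw [Real.log_div (by norm_num) hs.ne'] at hT
      have h3 : Real.log 2.12 ≤ Real.log (9 / 2) / 2 := by
        rw [← Real.log_sqrt (by norm_num)]
        apply Real.log_le_log (by norm_num)
        exact Real.le_sqrt_of_sq_le (by norm_num)
      linarith
    have h3 : 16 * (16 + 15 * s) / (16 - 15 * s) / 16 ≤ 2.2 := by
      rw [div_div, div_le_iff₀ (by positivity)]
      linarith
    calc _ ≤ 2.2 / 2.718 * (√s / 2.12) := by gcongr
      _ = 2.2 / 2.718 / 2.12 * √s := by ring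
      _ ≤ _ := mul_le_mul_of_nonneg_right (by norm_num) hq.le

/-- The eigendirections with eigenvalue above `-√ε / 4` become negligible against the most
negative one. -/
lemma subdominant_growth_le {s w : ℝ} {T : ℕ} (hs : 0 < s) (hs1 : s < 1)
    (hw : Real.exp (-(T * s) / 8) ≤ w) :
    (1 + s / 4) ^ T ≤ w ^ 3 * (1 + s) ^ T := by
  have h := inv_one_add_pow_le_exp (x := 3 * s / (4 + s)) (by positivity) T
  have e1 : (1 + 3 * s / (4 + s))⁻¹ = (1 + s / 4) / (1 + s) := by
    field_simp
    ring
  have e2 : 2 * (3 * s / (4 + s)) / (3 * s / (4 + s) + 2) = 6 * s / (8 + 5 * s) := by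
    have : 3 * s / (4 + s) + 2 = (8 + 5 * s) / (4 + s) := by
      field_simp
      ring
    rw [this]
    field_simp
    ring
  rw [e1, e2, div_pow, div_le_iff₀ (by positivity)] at h
  refine h.trans ?_
  gcongr
  calc Real.exp (-(T * (6 * s / (8 + 5 * s)))) ≤ Real.exp ((3 : ℕ) * (-(T * s) / 8)) := by
        apply Real.exp_le_exp.mpr
        have h2 : 3 / 8 * s ≤ 6 * s / (8 + 5 * s) := by
          rw [le_div_iff₀ (by positivity)]
          nlinarith
        have := mul_le_mul_of_nonneg_left h2 (Nat.cast_nonneg (α := ℝ) T)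
        push_cast
        linarith
    _ = Real.exp (-(T * s) / 8) ^ 3 := Real.exp_nat_mul _ _
    _ ≤ w ^ 3 := by gcongr

/-! ### The uniform distribution on a ball -/

/-- Log-convexity of the Gamma function at the midpoint of `(k + 1) / 2` and `(k + 3) / 2`. -/
lemma Gamma_half_add_one_le {k : ℝ} (hk : 1 ≤ k) :
    Real.Gamma (k / 2 + 1) ≤ √k * Real.Gamma ((k + 1) / 2) := by
  have h0 : 0 < (k + 1) / 2 := by linarith
  have hG := Real.Gamma_pos_of_pos h0
  have h := Real.Gamma_mul_add_mul_le_rpow_Gamma_mul_rpow_Gamma (s := (k + 1) / 2)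
    (t := (k + 1) / 2 + 1) (a := 1 / 2) (b := 1 / 2) h0 (by linarith) (by norm_num)
    (by norm_num) (by norm_num)
  have e1 : 1 / 2 * ((k + 1) / 2) + 1 / 2 * ((k + 1) / 2 + 1) = k / 2 + 1 := by ring
  rw [e1, ← Real.sqrt_eq_rpow, ← Real.sqrt_eq_rpow, Real.Gamma_add_one h0.ne',
    Real.sqrt_mul h0.le, mul_left_comm, Real.mul_self_sqrt hG.le] at h
  refine h.trans ?_
  gcongr
  linarith

lemma volume_closedBall_fin (j : ℕ) {r : ℝ} (hr : 0 < r) :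
    volume (Metric.closedBall (0 : EuclideanSpace ℝ (Fin j)) r) =
      ENNReal.ofReal (r ^ j * (√Real.pi ^ j / Real.Gamma (j / 2 + 1))) := by
  rcases Nat.eq_zero_or_pos j with rfl | hj
  · rw [volume_euclideanSpace_eq_dirac, Measure.dirac_apply' _ measurableSet_closedBall]
    simp [hr.le]
  · have : Nonempty (Fin j) := ⟨⟨0, hj⟩⟩
    rw [EuclideanSpace.volume_closedBall, ENNReal.ofReal_mul (by positivity),
      ENNReal.ofReal_pow hr.le, Fintype.card_fin]

/-- The slab `|⟪b i, y⟫| ≤ c` of a ball is contained in a cylinder over a ball of one dimension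
less. -/
lemma volume_slab_le {E : Type*} [NormedAddCommGroup E] [InnerProductSpace ℝ E]
    [FiniteDimensional ℝ E] [MeasurableSpace E] [BorelSpace E] {j : ℕ}
    (b : OrthonormalBasis (Fin (j + 1)) ℝ E) (i : Fin (j + 1)) (r c : ℝ) :
    volume (Metric.closedBall (0 : E) r ∩ {y | |inner ℝ (b i) y| ≤ c}) ≤
      ENNReal.ofReal (2 * c) * volume (Metric.closedBall (0 : EuclideanSpace ℝ (Fin j)) r) := by
  have h1 := b.measurePreserving_repr
  have h2 := PiLp.volume_preserving_ofLp (Fin (j + 1))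
  have h3 := volume_preserving_piFinSuccAbove (fun _ : Fin (j + 1) => ℝ) i
  have h4 := (MeasurePreserving.id (volume : Measure ℝ)).prod
    (PiLp.volume_preserving_toLp (Fin j))
  have h := h4.comp (h3.comp (h2.comp h1))
  have hm : MeasurableSet (Set.Icc (-c) c ×ˢ
      Metric.closedBall (0 : EuclideanSpace ℝ (Fin j)) r) :=
    measurableSet_Icc.prod measurableSet_closedBall
  have hv := h.measure_preimage hm.nullMeasurableSet
  rw [Measure.prod_prod, Real.volume_Icc] at hv
  have e : c - -c = 2 * c := by ring
  rw [e] at hv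
  rw [← hv]
  apply measure_mono
  rintro y ⟨hy1, hy2⟩
  refine Set.mem_preimage.mpr ⟨?_, ?_⟩
  · have hc : |b.repr y i| ≤ c := by rwa [b.repr_apply_apply]
    exact abs_le.mp hc
  · have hy : ‖y‖ ≤ r := by simpa using hy1
    rw [mem_closedBall_zero_iff]
    refine le_trans ?_ hy
    rw [EuclideanSpace.norm_eq, ← b.repr.norm_map y, EuclideanSpace.norm_eq]
    apply Real.sqrt_le_sqrt
    rw [Fin.sum_univ_succAbove _ i]
    simp only [Function.comp, Prod.map_snd, MeasurableEquiv.piFinSuccAbove]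
    exact le_add_of_nonneg_left (by positivity)

/-- Anti-concentration: a point of a ball of radius `r` in dimension `k` has a coordinate of
absolute value at most `r δ √(π / k) / 2` with probability at most `δ`. -/
lemma volume_slab_le_mul_volume_closedBall {E : Type*} [NormedAddCommGroup E]
    [InnerProductSpace ℝ E] [FiniteDimensional ℝ E] [MeasurableSpace E] [BorelSpace E] {k : ℕ}
    (b : OrthonormalBasis (Fin k) ℝ E) (i : Fin k) {r δ : ℝ} (hr : 0 < r) (hδ : 0 < δ) :
    volume (Metric.closedBall (0 : E) r ∩
        {y | |inner ℝ (b i) y| ≤ r * (δ * √(Real.pi / k) / 2)}) ≤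
      ENNReal.ofReal δ * volume (Metric.closedBall (0 : E) r) := by
  obtain ⟨j, rfl⟩ : ∃ j, k = j + 1 := ⟨k - 1, by have := i.pos; omega⟩
  refine (volume_slab_le b i r _).trans ?_
  have hball : volume (Metric.closedBall (0 : E) r)
      = volume (Metric.closedBall (0 : EuclideanSpace ℝ (Fin (j + 1))) r) := by
    rw [← b.measurePreserving_repr.measure_preimage measurableSet_closedBall.nullMeasurableSet]
    congr 1
    ext y
    simp
  rw [hball, volume_closedBall_fin _ hr, volume_closedBall_fin _ hr,
    ← ENNReal.ofReal_mul (by positivity), ← ENNReal.ofReal_mul hδ.le]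
  apply ENNReal.ofReal_le_ofReal
  have hk : (1 : ℝ) ≤ ((j + 1 : ℕ) : ℝ) := by exact_mod_cast Nat.succ_le_succ (Nat.zero_le j)
  have hG := Gamma_half_add_one_le hk
  set κ : ℝ := ((j + 1 : ℕ) : ℝ) with hκ
  have e1 : (j : ℝ) / 2 + 1 = (κ + 1) / 2 := by
    rw [hκ]
    push_cast
    ring
  rw [e1]
  have hκ0 : 0 < κ := by linarith
  have g1 := Real.Gamma_pos_of_pos (show (0 : ℝ) < (κ + 1) / 2 by positivity)
  have g2 := Real.Gamma_pos_of_pos (show (0 : ℝ) < κ / 2 + 1 by positivity)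
  rw [Real.sqrt_div Real.pi_pos.le]
  have hsk : 0 < √κ := Real.sqrt_pos.mpr hκ0
  calc 2 * (r * (δ * (√Real.pi / √κ) / 2)) *
        (r ^ j * (√Real.pi ^ j / Real.Gamma ((κ + 1) / 2)))
      = δ * (r ^ (j + 1) * (√Real.pi ^ (j + 1) / (√κ * Real.Gamma ((κ + 1) / 2)))) := by
        field_simp
        ring
    _ ≤ _ := by gcongr

/-! ### The perturbed power iteration -/

lemma norm_le_two_pow_mul {E : Type*} [SeminormedAddCommGroup E] {y : ℕ → E}
    (hy : ∀ t, ‖y (t + 1)‖ ≤ 2 * ‖y t‖) (t : ℕ) :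
    ‖y t‖ ≤ 2 ^ t * ‖y 0‖ := by
  induction t with
  | zero => simp
  | succ t ih =>
    rw [pow_succ]
    linarith [hy t]

section PowerIteration

variable {E : Type*} [NormedAddCommGroup E] [InnerProductSpace ℝ E]

/-- Each step contributes an error of at most `η 2^t ‖y 0‖`, which the remaining steps at most
double each. -/
lemma two_mul_norm_sub_iterate_le {y : ℕ → E} {M : E →ₗ[ℝ] E} {η : ℝ} (hη : 0 ≤ η)
    (hM : ∀ v, ‖M v‖ ≤ 2 * ‖v‖) (hy : ∀ t, ‖y (t + 1)‖ ≤ 2 * ‖y t‖)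
    (hstep : ∀ t, ‖y (t + 1) - M (y t)‖ ≤ η * ‖y t‖) (t : ℕ) :
    2 * ‖y t - (M ^ t) (y 0)‖ ≤ t * 2 ^ t * η * ‖y 0‖ := by
  induction t with
  | zero => simp
  | succ t ih =>
    have e : y (t + 1) - (M ^ (t + 1)) (y 0)
        = (y (t + 1) - M (y t)) + M (y t - (M ^ t) (y 0)) := by
      rw [pow_succ', Module.End.mul_apply, map_sub]
      abel
    have h1 := norm_add_le (y (t + 1) - M (y t)) (M (y t - (M ^ t) (y 0)))
    have h2 := hM (y t - (M ^ t) (y 0))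
    have h3 := mul_le_mul_of_nonneg_left (norm_le_two_pow_mul hy t) hη
    rw [e, pow_succ]
    push_cast
    linarith [hstep t]

lemma inner_pow_apply_of_eigenvector {M : E →ₗ[ℝ] E} (hM : M.IsSymmetric) {u : E} {μ : ℝ}
    (hu : M u = μ • u) (v : E) (t : ℕ) :
    inner ℝ u ((M ^ t) v) = μ ^ t * inner ℝ u v := by
  induction t with
  | zero => simp
  | succ t ih =>
    rw [pow_succ', Module.End.mul_apply, ← hM, hu, real_inner_smul_left, ih, pow_succ]
    ring

/-- The deterministic part of the argument. The iteration `y (t + 1) ≈ y t - H (y t)`, with a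
relative error `η` per step, is compared with the powers of `1 - H` in an orthonormal eigenbasis
of `H`. If the component of `y 0` along an eigenvector of eigenvalue at most `-s` is not too small
(at least `β r`), then after `T` steps it outweighs the components with eigenvalue above
`-s / 4`. -/
lemma rayleigh_le_of_powerIteration {ι : Type*} [Fintype ι]
    (B : OrthonormalBasis ι ℝ E) {H : E →ₗ[ℝ] E} (hH : H.IsSymmetric) {lam : ι → ℝ}
    (hB : ∀ i, H (B i) = lam i • B i) (hnorm : ∀ v, ‖H v‖ ≤ ‖v‖) {s β r η : ℝ} {T : ℕ}
    (hs : 0 < s) (hs1 : s < 1) (hβ : 0 < β) (hr : 0 < r) (hη : 0 ≤ η) {i₀ : ι}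
    (hi₀ : lam i₀ ≤ -s) {y : ℕ → E} (hy : ∀ t, ‖y (t + 1)‖ ≤ 2 * ‖y t‖)
    (hstep : ∀ t, ‖y (t + 1) - (y t - H (y t))‖ ≤ η * ‖y t‖)
    (hr0 : ‖y 0‖ ≤ r) (hβ0 : r * β ≤ |inner ℝ (B i₀) (y 0)|)
    (hlow : (1 + s / 4) ^ T ≤ √s / 80 * ((1 + s) ^ T * β))
    (herr : T * 2 ^ T * η / 2 ≤ 21 / 50 * √s * ((1 + s) ^ T * β)) :
    y T ≠ 0 ∧ inner ℝ (y T) (H (y T)) ≤ -(s / 4) * ‖y T‖ ^ 2 := by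
  classical
  set M : E →ₗ[ℝ] E := LinearMap.id - H with hMdef
  have hMapp : ∀ v, M v = v - H v := fun v => rfl
  have hMsymm : M.IsSymmetric := fun v w => by
    rw [hMapp, hMapp, inner_sub_left, inner_sub_right, hH v w]
  have hMB : ∀ i, M (B i) = (1 - lam i) • B i := fun i => by
    rw [hMapp, hB, sub_smul, one_smul]
  have hM2 : ∀ v, ‖M v‖ ≤ 2 * ‖v‖ := fun v => by
    rw [hMapp]
    linarith [norm_sub_le v (H v), hnorm v]
  have hlam : ∀ i, lam i ≤ 1 := fun i => by
    have h := hnorm (B i)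
    rw [hB, norm_smul, B.norm_eq_one, mul_one, Real.norm_eq_abs] at h
    exact (abs_le.mp h).2
  set Q : ℝ := (1 + s) ^ T * (r * β) with hQ
  have hQ0 : 0 < Q := by positivity
  have hq : √s * √s = s := Real.mul_self_sqrt hs.le
  have hq0 : 0 ≤ √s := Real.sqrt_nonneg s
  have hq1 : √s ≤ 1 := by nlinarith
  set e : E := y T - (M ^ T) (y 0) with he
  have hE : ‖e‖ ≤ 21 / 50 * √s * Q := by
    have h1 := two_mul_norm_sub_iterate_le hη hM2 hy hstep T
    have h2 : T * 2 ^ T * η * ‖y 0‖ ≤ T * 2 ^ T * η * r := by gcongr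
    have h3 := mul_le_mul_of_nonneg_right herr hr.le
    rw [← he] at h1
    rw [hQ]
    linarith
  have hcoord : ∀ i, inner ℝ (B i) (y T)
      = (1 - lam i) ^ T * inner ℝ (B i) (y 0) + inner ℝ (B i) e := fun i => by
    rw [he, inner_sub_right, inner_pow_apply_of_eigenvector hMsymm (hMB i)]
    ring
  -- the error takes away at most the fraction `21 / 50` of the component along `B i₀`
  have hmain : 29 / 50 * Q ≤ |inner ℝ (B i₀) (y T)| := by
    have h1 : |inner ℝ (B i₀) e| ≤ ‖e‖ := by
      have := abs_real_inner_le_norm (B i₀) e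
      rwa [B.norm_eq_one, one_mul] at this
    have h2 : Q ≤ |(1 - lam i₀) ^ T * inner ℝ (B i₀) (y 0)| := by
      rw [abs_mul, abs_of_nonneg (pow_nonneg (by linarith) T)]
      have : (1 + s) ^ T ≤ (1 - lam i₀) ^ T := by
        gcongr
        linarith
      exact mul_le_mul this hβ0 (by positivity) (pow_nonneg (by linarith) T)
    have h3 := abs_sub_abs_le_abs_sub ((1 - lam i₀) ^ T * inner ℝ (B i₀) (y 0))
      (-inner ℝ (B i₀) e)
    rw [sub_neg_eq_add, ← hcoord, abs_neg] at h3
    have h4 : 21 / 50 * √s * Q ≤ 21 / 50 * 1 * Q := by gcongr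
    linarith
  have hne : y T ≠ 0 := by
    intro h0
    rw [h0, inner_zero_right, abs_zero] at hmain
    linarith
  refine ⟨hne, ?_⟩
  have hsum : ∀ v : E, ∑ i, inner ℝ (B i) v ^ 2 = ‖v‖ ^ 2 := fun v => by
    simpa [Real.norm_eq_abs, sq_abs] using B.sum_sq_norm_inner_right v
  have hray : inner ℝ (y T) (H (y T)) = ∑ i, lam i * inner ℝ (B i) (y T) ^ 2 := by
    rw [← B.sum_inner_mul_inner]
    refine Finset.sum_congr rfl fun i _ => ?_
    rw [← hH, hB, real_inner_smul_left, real_inner_comm]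
    ring
  -- `21` and `21 / 20` are conjugate weights in `(a + b)² ≤ 21 a² + (21 / 20) b²`
  set R : ι → ℝ := fun i => (1 + s / 4) *
    (21 * ((1 + s / 4) ^ T * inner ℝ (B i) (y 0)) ^ 2 + 21 / 20 * inner ℝ (B i) e ^ 2) with hR
  have hR0 : ∀ i, 0 ≤ R i := fun i => by
    simp only [hR]
    positivity
  have hterm : ∀ i, (lam i + s / 4) * inner ℝ (B i) (y T) ^ 2 ≤ R i := fun i => by
    rcases le_total (lam i + s / 4) 0 with h | h
    · exact (mul_nonpos_of_nonpos_of_nonneg h (sq_nonneg _)).trans (hR0 i)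
    -- here `0 ≤ 1 - lam i ≤ 1 + s / 4`, so this component grows slowly
    · have h1 : ((1 - lam i) ^ T * inner ℝ (B i) (y 0)) ^ 2
          ≤ ((1 + s / 4) ^ T * inner ℝ (B i) (y 0)) ^ 2 := by
        rw [mul_pow, mul_pow]
        have hl := hlam i
        have h0 : 0 ≤ 1 - lam i := by linarith
        have h3 : 1 - lam i ≤ 1 + s / 4 := by linarith
        gcongr
      have h2 : inner ℝ (B i) (y T) ^ 2 ≤
          21 * ((1 - lam i) ^ T * inner ℝ (B i) (y 0)) ^ 2 + 21 / 20 * inner ℝ (B i) e ^ 2 := by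
        rw [hcoord]
        nlinarith [sq_nonneg (20 * ((1 - lam i) ^ T * inner ℝ (B i) (y 0)) - inner ℝ (B i) e)]
      simp only [hR]
      apply mul_le_mul
      · linarith [hlam i]
      · linarith
      · positivity
      · positivity
  have hRsum : ∑ i, R i ≤ 1 / 4 * s * Q ^ 2 := by
    have e1 : ∑ i, R i = (1 + s / 4) *
        (21 * ((1 + s / 4) ^ T * ‖y 0‖) ^ 2 + 21 / 20 * ‖e‖ ^ 2) := by
      simp only [hR]
      rw [← Finset.mul_sum, Finset.sum_add_distrib, ← Finset.mul_sum, ← Finset.mul_sum, hsum]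
      simp only [mul_pow]
      rw [← Finset.mul_sum, hsum]
    have h1 : (1 + s / 4) ^ T * ‖y 0‖ ≤ √s / 80 * Q := by
      calc (1 + s / 4) ^ T * ‖y 0‖ ≤ √s / 80 * ((1 + s) ^ T * β) * r := by gcongr
        _ = _ := by rw [hQ]; ring
    have h2 : ((1 + s / 4) ^ T * ‖y 0‖) ^ 2 ≤ (√s / 80 * Q) ^ 2 := by gcongr
    have h3 : ‖e‖ ^ 2 ≤ (21 / 50 * √s * Q) ^ 2 := by gcongr
    have e2 : (√s / 80 * Q) ^ 2 = 1 / 6400 * (s * Q ^ 2) := by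
      linear_combination 1 / 6400 * Q ^ 2 * hq
    have e3 : (21 / 50 * √s * Q) ^ 2 = 441 / 2500 * (s * Q ^ 2) := by
      linear_combination 441 / 2500 * Q ^ 2 * hq
    rw [e1]
    calc _ ≤ (1 + 1 / 4) * (21 * (1 / 6400 * (s * Q ^ 2))
          + 21 / 20 * (441 / 2500 * (s * Q ^ 2))) := by
          rw [← e2, ← e3]
          gcongr
      _ ≤ _ := by
          have : 0 ≤ s * Q ^ 2 := by positivity
          linarith
  have hsplit : ∑ i, (lam i + s / 4) * inner ℝ (B i) (y T) ^ 2 ≤ 0 := by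
    rw [← Finset.add_sum_erase _ _ (Finset.mem_univ i₀)]
    have h1 : ∑ i ∈ Finset.univ.erase i₀, (lam i + s / 4) * inner ℝ (B i) (y T) ^ 2
        ≤ ∑ i, R i :=
      (Finset.sum_le_sum fun i _ => hterm i).trans
        (Finset.sum_le_sum_of_subset_of_nonneg (Finset.erase_subset _ _) fun i _ _ => hR0 i)
    have h2 : (29 / 50 * Q) ^ 2 ≤ inner ℝ (B i₀) (y T) ^ 2 := by
      rw [← sq_abs (inner ℝ (B i₀) (y T))]
      gcongr
    have h3 : 3 / 4 * s * (29 / 50 * Q) ^ 2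
        ≤ -(lam i₀ + s / 4) * inner ℝ (B i₀) (y T) ^ 2 :=
      mul_le_mul (by linarith) h2 (by positivity) (by linarith)
    have h4 : 0 ≤ s * Q ^ 2 := by positivity
    nlinarith
  simp only [add_mul] at hsplit
  rw [Finset.sum_add_distrib, ← Finset.mul_sum, hsum, ← hray] at hsplit
  linarith

lemma inner_apply_normalized_le {H : E →ₗ[ℝ] E} {v : E} (hv : v ≠ 0) {c : ℝ}
    (h : inner ℝ v (H v) ≤ c * ‖v‖ ^ 2) :
    inner ℝ (‖v‖⁻¹ • v) (H (‖v‖⁻¹ • v)) ≤ c := by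
  have hvn : 0 < ‖v‖ := norm_pos_iff.mpr hv
  rw [map_smul, real_inner_smul_left, real_inner_smul_right]
  calc _ ≤ ‖v‖⁻¹ * (‖v‖⁻¹ * (c * ‖v‖ ^ 2)) := by gcongr
    _ = c := by field_simp

end PowerIteration

/-! ### The gradient and the Hessian in the scaled coordinates -/

section Scaling

variable {m n : ℕ}

lemma scaling_apply (x v : EuclideanSpace ℝ (Fin n)) (i : Fin n) :
    scaling x v i = x i * v i := by
  simp [scaling, Matrix.mulVec_diagonal]

lemma scaling_ones (x : EuclideanSpace ℝ (Fin n)) : scaling x (ones n) = x := by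
  ext i
  simp [scaling_apply, ones]

lemma inner_scaling_left (x u v : EuclideanSpace ℝ (Fin n)) :
    inner ℝ (scaling x u) v = inner ℝ u (scaling x v) := by
  simp only [PiLp.inner_apply, scaling_apply]
  refine Finset.sum_congr rfl fun i _ => ?_
  simp only [RCLike.inner_apply, conj_trivial]
  ring

lemma scaling_ones_add_mem_strictInterior {A : Matrix (Fin m) (Fin n) ℝ} {b : Fin m → ℝ}
    {x : EuclideanSpace ℝ (Fin n)} (hx : x ∈ strictInterior A b)
    {d : EuclideanSpace ℝ (Fin n)} (hd : d ∈ kerAX A x) (hd1 : ‖d‖ < 1) :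
    scaling x (ones n + d) ∈ strictInterior A b := by
  refine ⟨?_, fun i => ?_⟩
  · have h : A.mulVec ((Matrix.diagonal x.ofLp).mulVec d.ofLp) = 0 := by
      have h0 : Matrix.toEuclideanLin (A * Matrix.diagonal x.ofLp) d = 0 := hd
      rw [Matrix.mulVec_mulVec]
      simpa [Matrix.toLpLin_apply] using h0
    rw [map_add, scaling_ones]
    have e : (scaling x d).ofLp = (Matrix.diagonal x.ofLp).mulVec d.ofLp := by
      ext i
      simp [scaling_apply, Matrix.mulVec_diagonal]
    rw [WithLp.ofLp_add, Matrix.mulVec_add, e, h, add_zero]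
    exact hx.1
  · have h1 : |d i| < 1 := (PiLp.norm_apply_le d i).trans_lt hd1
    have h2 := (abs_lt.mp h1).1
    rw [scaling_apply]
    have h3 : (ones n + d) i = 1 + d i := by simp [ones]
    rw [h3]
    exact mul_pos (hx.2 i) (by linarith)

lemma isOpen_posOrthant : IsOpen (posOrthant n) := by
  have e : posOrthant n = ⋂ i, {x : EuclideanSpace ℝ (Fin n) | 0 < x i} := by
    ext x
    simp [posOrthant]
  rw [e]
  exact isOpen_iInter_of_finite fun i => isOpen_lt continuous_const (by fun_prop)

lemma inner_hessian_left {A : Matrix (Fin m) (Fin n) ℝ} {b : Fin m → ℝ}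
    {f : EuclideanSpace ℝ (Fin n) → ℝ} (hf : TwiceDifferentiableOnInterior A b f)
    {x : EuclideanSpace ℝ (Fin n)} (hx : x ∈ strictInterior A b)
    (u v : EuclideanSpace ℝ (Fin n)) :
    inner ℝ (hessian f x u) v = inner ℝ u (hessian f x v) := by
  have h1 : ∀ᶠ y in nhds x, HasFDerivAt f
      (InnerProductSpace.toDual ℝ (EuclideanSpace ℝ (Fin n)) (gradient f y)) y := by
    filter_upwards [isOpen_posOrthant.mem_nhds (show x ∈ posOrthant n from hx.2)] with y hy
    exact ((hf.differentiableOn y hy).differentiableAt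
      (isOpen_posOrthant.mem_nhds hy)).hasGradientAt.hasFDerivAt
  have h2 := (hf.differentiableAt_gradient x hx).hasFDerivAt
  have h3 := (InnerProductSpace.toDual ℝ
    (EuclideanSpace ℝ (Fin n))).toContinuousLinearEquiv.toContinuousLinearMap.hasFDerivAt.comp x h2
  have h := second_derivative_symmetric_of_eventually h1 h3 u v
  rw [real_inner_comm (hessian f x v) u]
  simpa [hessian] using h

/-- The gradient in the scaled coordinates, relative to its value at the centre and projected to
the kernel: `d ↦ P X (∇f(X(e + d)) - ∇f(x))`. -/
noncomputable def scaledGradient (A : Matrix (Fin m) (Fin n) ℝ) (f : EuclideanSpace ℝ (Fin n) → ℝ)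
    (x : EuclideanSpace ℝ (Fin n)) (d : kerAX A x) : kerAX A x :=
  (kerAX A x).orthogonalProjectionOnto
    (scaling x (gradient f (scaling x (ones n + d)) - gradient f x))

lemma scaledGradient_zero (A : Matrix (Fin m) (Fin n) ℝ) (f : EuclideanSpace ℝ (Fin n) → ℝ)
    (x : EuclideanSpace ℝ (Fin n)) : scaledGradient A f x 0 = 0 := by
  simp [scaledGradient, scaling_ones]

variable {A : Matrix (Fin m) (Fin n) ℝ} {b : Fin m → ℝ} {f : EuclideanSpace ℝ (Fin n) → ℝ}
  {γ l ρ : ℝ} {x : EuclideanSpace ℝ (Fin n)}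

lemma hasFDerivAt_scaledGradient (hf : TwiceDifferentiableOnInterior A b f)
    (hx : x ∈ strictInterior A b) {d : kerAX A x} (hd : ‖d‖ < 1) :
    HasFDerivAt (scaledGradient A f x)
      (compression (kerAX A x) (scaledHessian f x (scaling x (ones n + d)))) d := by
  set φ : kerAX A x → EuclideanSpace ℝ (Fin n) := fun d => scaling x (ones n + d) with hφ
  have h1 : HasFDerivAt (gradient f) (hessian f (φ d)) (φ d) :=
    (hf.differentiableAt_gradient _
      (scaling_ones_add_mem_strictInterior hx d.2 hd)).hasFDerivAt
  have h0 : HasFDerivAt φ (scaling x ∘L (kerAX A x).subtypeL) d :=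
    (scaling x).hasFDerivAt.comp d ((kerAX A x).subtypeL.hasFDerivAt.const_add (ones n))
  have h2 := (h1.comp d h0).sub_const (gradient f x)
  have h3 := (((kerAX A x).orthogonalProjectionOnto ∘L scaling x).hasFDerivAt
    (x := gradient f (φ d) - gradient f x)).comp d h2
  exact h3

lemma norm_scaledGradient_sub_le (hgrad : ScaledGradientLipschitz A b f γ l)
    (hx : x ∈ strictInterior A b) {d d' : kerAX A x} (hd : ‖d‖ ≤ γ) (hd' : ‖d'‖ ≤ γ) :
    ‖scaledGradient A f x d - scaledGradient A f x d'‖ ≤ l * ‖d - d'‖ := by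
  rw [scaledGradient, scaledGradient, ← map_sub]
  refine ((kerAX A x).norm_orthogonalProjectionOnto_apply_le _).trans ?_
  rw [← map_sub, sub_sub_sub_cancel_right]
  exact hgrad.bound x hx d d.2 d' d'.2 hd hd'

lemma norm_compression_le (K : Submodule ℝ (EuclideanSpace ℝ (Fin n)))
    (M : EuclideanSpace ℝ (Fin n) →L[ℝ] EuclideanSpace ℝ (Fin n)) :
    ‖compression K M‖ ≤ ‖M‖ := by
  refine ContinuousLinearMap.opNorm_le_bound _ (norm_nonneg _) fun v => ?_
  exact (K.norm_orthogonalProjectionOnto_apply_le _).trans (M.le_opNorm v)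

lemma norm_compression_scaledHessian_sub_le (hhess : ScaledHessianLipschitz A b f γ ρ)
    (hx : x ∈ strictInterior A b) {d d' : kerAX A x} (hd : ‖d‖ ≤ γ) (hd' : ‖d'‖ ≤ γ) :
    ‖compression (kerAX A x) (scaledHessian f x (scaling x (ones n + d))) -
      compression (kerAX A x) (scaledHessian f x (scaling x (ones n + d')))‖ ≤ ρ * ‖d - d'‖ := by
  have e : compression (kerAX A x) (scaledHessian f x (scaling x (ones n + d))) -
      compression (kerAX A x) (scaledHessian f x (scaling x (ones n + d'))) =
      compression (kerAX A x) (scaling x ∘L (hessian f (scaling x (ones n + d)) -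
        hessian f (scaling x (ones n + d'))) ∘L scaling x) := by
    ext v
    simp [compression, scaledHessian]
  rw [e]
  exact (norm_compression_le _ _).trans (hhess.bound x hx d d.2 d' d'.2 hd hd')

/-- The scaled gradient is `l`-Lipschitz near `0`, hence its derivative at `0` has norm at
most `l`. -/
lemma norm_compression_scaledHessian_le (hγ : 0 < γ) (hl : 0 ≤ l)
    (hgrad : ScaledGradientLipschitz A b f γ l) (hx : x ∈ strictInterior A b) :
    ‖compression (kerAX A x) (scaledHessian f x x)‖ ≤ l := by
  have h := hasFDerivAt_scaledGradient hgrad.twiceDifferentiable hx (d := (0 : kerAX A x))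
    (by simp)
  rw [ZeroMemClass.coe_zero, add_zero, scaling_ones] at h
  refine h.le_of_lip' hl ?_
  filter_upwards [Metric.closedBall_mem_nhds (0 : kerAX A x) hγ] with d hd
  exact norm_scaledGradient_sub_le hgrad hx (by simpa using hd) (by simpa using hγ.le)

/-- The second-order Taylor bound for the scaled gradient at `0`. -/
lemma norm_scaledGradient_sub_compression_le (hγ : 0 < γ) (hγ1 : γ < 1)
    (hhess : ScaledHessianLipschitz A b f γ ρ) (hx : x ∈ strictInterior A b)
    {d : kerAX A x} (hd : ‖d‖ ≤ γ) :
    ‖scaledGradient A f x d - compression (kerAX A x) (scaledHessian f x x) d‖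
      ≤ ρ / 2 * ‖d‖ ^ 2 := by
  set H : kerAX A x → (kerAX A x →L[ℝ] kerAX A x) := fun d =>
    compression (kerAX A x) (scaledHessian f x (scaling x (ones n + d))) with hH
  have hH0 : compression (kerAX A x) (scaledHessian f x x) = H 0 := by
    simp [hH, scaling_ones]
  rw [hH0]
  have htd : ∀ t ∈ Set.Icc (0 : ℝ) 1, ‖t • d‖ ≤ γ := fun t ht => by
    rw [norm_smul, Real.norm_eq_abs, abs_of_nonneg ht.1]
    exact (mul_le_of_le_one_left (norm_nonneg d) ht.2).trans hd
  have hderiv : ∀ t ∈ Set.Icc (0 : ℝ) 1,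
      HasDerivAt (fun t : ℝ => scaledGradient A f x (t • d) - t • H 0 d)
        (H (t • d) d - H 0 d) t := fun t ht => by
    have h1 := hasFDerivAt_scaledGradient hhess.twiceDifferentiable hx
      ((htd t ht).trans_lt hγ1)
    have h2 : HasDerivAt (fun t : ℝ => t • d) d t := by
      simpa using (hasDerivAt_id t).smul_const d
    have h3 : HasDerivAt (fun t : ℝ => t • H 0 d) (H 0 d) t := by
      simpa using (hasDerivAt_id t).smul_const (H 0 d)
    exact (h1.comp_hasDerivAt t h2).sub h3
  have hB : ∀ t : ℝ, HasDerivAt (fun t : ℝ => ρ / 2 * ‖d‖ ^ 2 * t ^ 2) (ρ * ‖d‖ ^ 2 * t) t :=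
    fun t => ((hasDerivAt_pow 2 t).const_mul (ρ / 2 * ‖d‖ ^ 2)).congr_deriv (by
      norm_num
      ring)
  have h := image_norm_le_of_norm_deriv_right_le_deriv_boundary'
    (fun t ht => (hderiv t ht).continuousAt.continuousWithinAt)
    (fun t ht => (hderiv t ⟨ht.1, ht.2.le⟩).hasDerivWithinAt)
    (B := fun t : ℝ => ρ / 2 * ‖d‖ ^ 2 * t ^ 2) (by simp [scaledGradient_zero])
    (fun t _ => (hB t).continuousAt.continuousWithinAt)
    (fun t _ => (hB t).hasDerivWithinAt)
    (fun t ht => by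
      have h1 := norm_compression_scaledHessian_sub_le hhess hx (htd t ⟨ht.1, ht.2.le⟩)
        (show ‖(0 : kerAX A x)‖ ≤ γ by simpa using hγ.le)
      rw [sub_zero, norm_smul, Real.norm_eq_abs, abs_of_nonneg ht.1] at h1
      calc ‖H (t • d) d - H 0 d‖ ≤ ‖H (t • d) - H 0‖ * ‖d‖ := (H (t • d) - H 0).le_opNorm d
        _ ≤ ρ * (t * ‖d‖) * ‖d‖ := by gcongr
        _ = _ := by ring)
    (Set.right_mem_Icc.mpr zero_le_one)
  simpa using h

lemma isSymmetric_compression_scaledHessian (hf : TwiceDifferentiableOnInterior A b f)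
    (hx : x ∈ strictInterior A b) :
    (compression (kerAX A x) (scaledHessian f x x)).toLinearMap.IsSymmetric := fun u v => by
  simp only [compression, scaledHessian, ContinuousLinearMap.coe_coe,
    ContinuousLinearMap.comp_apply, Submodule.subtypeL_apply]
  rw [Submodule.inner_orthogonalProjectionOnto_eq_of_mem_left,
    Submodule.inner_orthogonalProjectionOnto_eq_of_mem_right, inner_scaling_left,
    inner_hessian_left hf hx, ← inner_scaling_left]

end Scaling

/-! ### The choice of the parameters -/

/-- With `s = √ε / l`, the number of steps is the least `T` for which `exp (-T s / 8)` is at most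
the reciprocal of the argument of the logarithm in `numSteps`. -/
lemma exp_neg_numSteps_le {n : ℕ} {l ε δ : ℝ} (hn : 0 < n) (hl : 0 < l) (hε : 0 < ε)
    (hδ : 0 < δ) :
    Real.exp (-(numSteps n l ε δ * (√ε / l)) / 8) ≤ √ε / l / 8 * (δ * √(Real.pi / n)) := by
  have hn' : (0 : ℝ) < n := by exact_mod_cast hn
  have hq : 0 < √ε := Real.sqrt_pos.mpr hε
  have hp := Real.pi_pos
  set w : ℝ := √ε / l / 8 * (δ * √(Real.pi / n)) with hw
  have hw0 : 0 < w := by positivity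
  have h := Nat.le_ceil (8 * l / √ε * Real.log (8 * l / δ * √(n / (Real.pi * ε))))
  have e1 : 8 * l / δ * √(n / (Real.pi * ε)) = w⁻¹ := by
    rw [hw, Real.sqrt_div' _ (by positivity), Real.sqrt_mul hp.le, Real.sqrt_div hp.le]
    have : 0 < √Real.pi := Real.sqrt_pos.mpr hp
    have : 0 < √(n : ℝ) := Real.sqrt_pos.mpr hn'
    field_simp
  rw [e1, Real.log_inv] at h
  rw [← Real.le_log_iff_exp_le hw0]
  have h2 := mul_le_mul_of_nonneg_right h (show 0 ≤ √ε / l by positivity)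
  have e2 : 8 * l / √ε * -Real.log w * (√ε / l) = -(8 * Real.log w) := by
    field_simp
  rw [e2] at h2
  rw [numSteps, e1, Real.log_inv]
  linarith

lemma subdominant_growth_numSteps_le {n k : ℕ} {l ε δ : ℝ} (hk : 0 < k) (hkn : k ≤ n)
    (hl : 0 < l) (hε : 0 < ε) (hεl : √ε < l) (hδ : 0 < δ) (hδ1 : δ < 1) :
    (1 + √ε / l / 4) ^ numSteps n l ε δ ≤
      √(√ε / l) / 80 * ((1 + √ε / l) ^ numSteps n l ε δ * (δ * √(Real.pi / k) / 2)) := by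
  have hw := exp_neg_numSteps_le (hk.trans_le hkn) hl hε hδ
  have hn1 : (1 : ℝ) ≤ n := by exact_mod_cast hk.trans_le hkn
  have hk' : (0 : ℝ) < k := by exact_mod_cast hk
  have hs : 0 < √ε / l := div_pos (Real.sqrt_pos.mpr hε) hl
  have hs1 : √ε / l < 1 := (div_lt_one hl).mpr hεl
  set s : ℝ := √ε / l
  have h := subdominant_growth_le hs hs1 hw
  refine h.trans ?_
  set w : ℝ := s / 8 * (δ * √(Real.pi / n)) with hwdef
  have hw0 : 0 ≤ w := by positivity
  have hp4 := Real.pi_lt_d2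
  -- `w ^ 2 ≤ π / 64 ≤ 1 / 20`
  have hw2 : w ^ 2 ≤ 1 / 20 := by
    have e : w ^ 2 = s ^ 2 * δ ^ 2 * (Real.pi / n) / 64 := by
      rw [hwdef, mul_pow, mul_pow, Real.sq_sqrt (by positivity)]
      ring
    have h1 : s ^ 2 ≤ 1 := pow_le_one₀ hs.le hs1.le
    have h2 : δ ^ 2 ≤ 1 := pow_le_one₀ hδ.le hδ1.le
    have h3 : Real.pi / n ≤ Real.pi := div_le_self Real.pi_pos.le hn1
    have h4 : s ^ 2 * δ ^ 2 * (Real.pi / n) ≤ 1 * 1 * Real.pi := by gcongr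
    rw [e]
    linarith
  have hwk : w ≤ s / 8 * (δ * √(Real.pi / k)) := by
    have : (k : ℝ) ≤ n := by exact_mod_cast hkn
    rw [hwdef]
    gcongr
  have hsq : s ≤ √s := Real.le_sqrt_of_sq_le (by nlinarith)
  have hw3 : w ^ 3 ≤ √s / 80 * (δ * √(Real.pi / k) / 2) := by
    calc w ^ 3 = w * w ^ 2 := by ring
      _ ≤ s / 8 * (δ * √(Real.pi / k)) * (1 / 20) := by gcongr
      _ = s / 80 * (δ * √(Real.pi / k) / 2) := by ring
      _ ≤ _ := by gcongr
  calc _ ≤ √s / 80 * (δ * √(Real.pi / k) / 2) * (1 + s) ^ numSteps n l ε δ := by gcongr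
    _ = _ := by ring

/-- The radius is so small that the linearization errors, accumulated over all steps, stay below
the guaranteed size of the most negative component. -/
lemma accumulated_error_le {n k : ℕ} {l ρ ε δ : ℝ} (hk : 0 < k) (hkn : k ≤ n)
    (hl : 0 < l) (hρ : 0 < ρ) (hε : 0 < ε) (hεl : √ε < l) (hδ : 0 < δ) (hδ1 : δ < 1) :
    numSteps n l ε δ * 2 ^ numSteps n l ε δ *
        (ρ * radius k (numSteps n l ε δ) l ρ ε δ / (2 * l)) / 2 ≤
      21 / 50 * √(√ε / l) * ((1 + √ε / l) ^ numSteps n l ε δ * (δ * √(Real.pi / k) / 2)) := by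
  have hw := exp_neg_numSteps_le (hk.trans_le hkn) hl hε hδ
  have hn1 : (1 : ℝ) ≤ n := by exact_mod_cast hk.trans_le hkn
  have hk' : (0 : ℝ) < k := by exact_mod_cast hk
  have hs : 0 < √ε / l := div_pos (Real.sqrt_pos.mpr hε) hl
  have hs1 : √ε / l < 1 := (div_lt_one hl).mpr hεl
  set T := numSteps n l ε δ
  have hrad : radius k T l ρ ε δ =
      ((1 + 7 * (√ε / l) / 8) / 2) ^ T / (8 * ρ) * (√ε * √(Real.pi / k)) * δ := by
    rw [radius, ← Real.sqrt_mul hε.le]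
    congr 2
    · congr 4
      field_simp
    · congr 1
      ring
  have e0 : √ε = √ε / l * l := by field_simp
  rw [hrad]
  set s : ℝ := √ε / l
  have hT : 8 * Real.log (9 / 2 / s) ≤ T * s := by
    have h1 : s / 8 * (δ * √(Real.pi / n)) ≤ (9 / 2 / s)⁻¹ := by
      have h2 : √(Real.pi / n) ≤ 16 / 9 := by
        rw [Real.sqrt_le_left (by norm_num)]
        have : Real.pi / n ≤ Real.pi := div_le_self Real.pi_pos.le hn1
        linarith [Real.pi_lt_d2]
      calc s / 8 * (δ * √(Real.pi / n)) ≤ s / 8 * (1 * (16 / 9)) := by gcongr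
        _ = (9 / 2 / s)⁻¹ := by
          rw [inv_div]
          ring
    have h3 := hw.trans h1
    rw [← Real.le_log_iff_exp_le (by positivity), Real.log_inv] at h3
    linarith
  have h := relative_error_le hs hs1 hT
  have e : T * 2 ^ T * (ρ * (((1 + 7 * s / 8) / 2) ^ T / (8 * ρ) * (√ε * √(Real.pi / k)) * δ) /
      (2 * l)) / 2 = T * s / 16 * ((1 + 7 * s / 8) / (1 + s)) ^ T *
        ((1 + s) ^ T * (δ * √(Real.pi / k) / 2)) := by
    rw [e0, div_pow, div_pow]
    field_simp
    ring
  rw [e]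
  gcongr

/-! ### The negative curvature procedure -/

section Procedure

variable {m n : ℕ} {A : Matrix (Fin m) (Fin n) ℝ} {b : Fin m → ℝ}
  {f : EuclideanSpace ℝ (Fin n) → ℝ} {γ l ρ r : ℝ} {x : EuclideanSpace ℝ (Fin n)}

/-- The iterates as elements of `ker(AX)`. -/
noncomputable def kerIterate (A : Matrix (Fin m) (Fin n) ℝ) (f : EuclideanSpace ℝ (Fin n) → ℝ)
    (x : EuclideanSpace ℝ (Fin n)) (l r : ℝ) (y₀ : kerAX A x) : ℕ → kerAX A x
  | 0 => y₀
  | t + 1 => kerIterate A f x l r y₀ t - (‖kerIterate A f x l r y₀ t‖ / (l * r)) •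
      scaledGradient A f x ((r / ‖kerIterate A f x l r y₀ t‖) • kerIterate A f x l r y₀ t)

lemma coe_kerIterate (y₀ : kerAX A x) (t : ℕ) :
    (kerIterate A f x l r y₀ t : EuclideanSpace ℝ (Fin n)) = powerIterate A f x l r y₀ t := by
  induction t with
  | zero => rfl
  | succ t ih =>
    rw [kerIterate, powerIterate, powerStep, ← ih]
    rfl

lemma norm_div_norm_smul_le {E : Type*} [NormedAddCommGroup E] [NormedSpace ℝ E] (hr : 0 ≤ r)
    (v : E) : ‖(r / ‖v‖) • v‖ ≤ r := by
  rw [norm_smul, Real.norm_eq_abs, abs_of_nonneg (by positivity), div_mul_eq_mul_div]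
  exact div_le_of_le_mul₀ (norm_nonneg v) hr le_rfl

lemma norm_kerIterate_succ_le (hl : 0 < l) (hr : 0 < r) (hrγ : r ≤ γ)
    (hgrad : ScaledGradientLipschitz A b f γ l) (hx : x ∈ strictInterior A b)
    (y₀ : kerAX A x) (t : ℕ) :
    ‖kerIterate A f x l r y₀ (t + 1)‖ ≤ 2 * ‖kerIterate A f x l r y₀ t‖ := by
  rw [kerIterate]
  set v := kerIterate A f x l r y₀ t
  have hd := norm_div_norm_smul_le hr.le v
  have h1 := norm_scaledGradient_sub_le hgrad hx (hd.trans hrγ)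
    (show ‖(0 : kerAX A x)‖ ≤ γ by simpa using hr.le.trans hrγ)
  rw [scaledGradient_zero, sub_zero, sub_zero] at h1
  refine (norm_sub_le _ _).trans ?_
  rw [norm_smul, Real.norm_eq_abs, abs_of_nonneg (by positivity)]
  calc _ ≤ ‖v‖ + ‖v‖ / (l * r) * (l * r) := by
        gcongr
        exact h1.trans (by gcongr)
    _ = 2 * ‖v‖ := by
        field_simp
        ring

lemma norm_kerIterate_succ_sub_le (hl : 0 < l) (hρ : 0 < ρ) (hr : 0 < r) (hrγ : r ≤ γ)
    (hγ1 : γ < 1) (hhess : ScaledHessianLipschitz A b f γ ρ) (hx : x ∈ strictInterior A b)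
    (y₀ : kerAX A x) (t : ℕ) :
    ‖kerIterate A f x l r y₀ (t + 1) - (kerIterate A f x l r y₀ t -
        l⁻¹ • compression (kerAX A x) (scaledHessian f x x) (kerIterate A f x l r y₀ t))‖ ≤
      ρ * r / (2 * l) * ‖kerIterate A f x l r y₀ t‖ := by
  rw [kerIterate]
  set v := kerIterate A f x l r y₀ t
  set H := compression (kerAX A x) (scaledHessian f x x)
  have hd := norm_div_norm_smul_le hr.le v
  have h1 := norm_scaledGradient_sub_compression_le (hr.trans_le hrγ) hγ1 hhess hx
    (hd.trans hrγ)
  have e : l⁻¹ • H v = (‖v‖ / (l * r)) • H ((r / ‖v‖) • v) := by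
    rcases eq_or_ne v 0 with h0 | h0
    · simp [h0]
    · have : ‖v‖ ≠ 0 := norm_ne_zero_iff.mpr h0
      rw [map_smul, smul_smul]
      congr 1
      field_simp
  rw [e, sub_sub_sub_cancel_left, ← smul_sub, norm_smul, norm_sub_rev, Real.norm_eq_abs,
    abs_of_nonneg (by positivity)]
  calc _ ≤ ‖v‖ / (l * r) * (ρ / 2 * r ^ 2) := by
        gcongr
        exact h1.trans (by gcongr)
    _ = _ := by
        field_simp

/-- A ball of the kernel, with a slab of small measure removed, has probability at least
`1 - δ`. -/
lemma one_sub_le_uniformBall {K : Submodule ℝ (EuclideanSpace ℝ (Fin n))} {k : ℕ}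
    (B : OrthonormalBasis (Fin k) ℝ K) (i : Fin k) {δ : ℝ} (hr : 0 < r) (hδ : 0 < δ) :
    1 - δ ≤ (uniformBall K r).real (Metric.closedBall (0 : K) r ∩
      {y | |inner ℝ (B i) y| ≤ r * (δ * √(Real.pi / k) / 2)}ᶜ) := by
  have hpos : volume (Metric.closedBall (0 : K) r) ≠ 0 :=
    (Metric.measure_closedBall_pos volume _ hr).ne'
  have hfin : volume (Metric.closedBall (0 : K) r) ≠ ⊤ := measure_closedBall_lt_top.ne
  have hm : MeasurableSet {y : K | |inner ℝ (B i) y| ≤ r * (δ * √(Real.pi / k) / 2)} :=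
    (isClosed_le (by fun_prop) continuous_const).measurableSet
  set S : Set K := {y : K | |inner ℝ (B i) y| ≤ r * (δ * √(Real.pi / k) / 2)}
  have : IsProbabilityMeasure (uniformBall K r) :=
    ProbabilityTheory.cond_isProbabilityMeasure_of_finite hpos hfin
  have e : uniformBall K r (Metric.closedBall (0 : K) r ∩ Sᶜ) = uniformBall K r Sᶜ := by
    rw [uniformBall, ProbabilityTheory.cond_inter_self measurableSet_closedBall]
  rw [Measure.real, e, ← Measure.real, probReal_compl_eq_one_sub hm]
  have h : uniformBall K r S ≤ ENNReal.ofReal δ := by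
    rw [uniformBall, ProbabilityTheory.cond_apply measurableSet_closedBall]
    calc _ ≤ (volume (Metric.closedBall (0 : K) r))⁻¹ *
          (ENNReal.ofReal δ * volume (Metric.closedBall (0 : K) r)) := by
          gcongr
          exact volume_slab_le_mul_volume_closedBall B i hr hδ
      _ = ENNReal.ofReal δ := by
          rw [mul_left_comm, ENNReal.inv_mul_cancel hpos hfin, mul_one]
  have := ENNReal.toReal_le_of_le_ofReal hδ.le h
  rw [Measure.real]
  linarith

/-- A minimum eigenvalue that is negative is not the value `0` given to the empty infimum, so there
is an eigenvalue below any bound `c ≤ 0` that it satisfies strictly. -/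
lemma exists_hasEigenvalue_lt_of_minEigenvalueOn_lt
    {K : Submodule ℝ (EuclideanSpace ℝ (Fin n))}
    {M : EuclideanSpace ℝ (Fin n) →L[ℝ] EuclideanSpace ℝ (Fin n)} {c : ℝ} (hc : c ≤ 0)
    (h : minEigenvalueOn K M < c) :
    ∃ μ < c, Module.End.HasEigenvalue (compression K M).toLinearMap μ := by
  have hne : {μ : ℝ | Module.End.HasEigenvalue (compression K M).toLinearMap μ}.Nonempty := by
    by_contra h0
    rw [minEigenvalueOn, Set.not_nonempty_iff_eq_empty.mp h0, Real.sInf_empty] at h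
    linarith
  obtain ⟨μ, hμ, hlt⟩ := exists_lt_of_csInf_lt hne h
  exact ⟨μ, hlt, hμ⟩

lemma nonneg_of_scaledGradientLipschitz [Nontrivial (kerAX A x)] (hγ : 0 < γ)
    (hgrad : ScaledGradientLipschitz A b f γ l) (hx : x ∈ strictInterior A b) : 0 ≤ l := by
  obtain ⟨d, hd⟩ := exists_norm_eq (kerAX A x) hγ.le
  have h := (norm_nonneg _).trans (norm_scaledGradient_sub_le hgrad hx hd.le
    (show ‖(0 : kerAX A x)‖ ≤ γ by simpa using hγ.le))
  rw [sub_zero, hd] at h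
  exact nonneg_of_mul_nonneg_left h hγ

end Procedure

end IPTR

theorem mainTheorem7 {m n : ℕ} (A : Matrix (Fin m) (Fin n) ℝ) (b : Fin m → ℝ)
    (f : EuclideanSpace ℝ (Fin n) → ℝ) (γ l ρ ε δ₀ : ℝ)
    (hγ_pos : 0 < γ) (hγ_lt : γ < 1) (hρ : 0 < ρ) (hε : 0 < ε)
    (hδ_pos : 0 < δ₀) (hδ_lt : δ₀ < 1)
    (hgrad : IPTR.ScaledGradientLipschitz A b f γ l)
    (hhess : IPTR.ScaledHessianLipschitz A b f γ ρ)
    (x : EuclideanSpace ℝ (Fin n)) (hx : x ∈ IPTR.strictInterior A b)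
    (hneg : IPTR.minEigenvalueOn (IPTR.kerAX A x) (IPTR.scaledHessian f x x) < -√ε)
    (k T : ℕ) (r : ℝ)
    (hk : k = Module.finrank ℝ (IPTR.kerAX A x))
    (hT : T = IPTR.numSteps n l ε δ₀)
    (hr : r = IPTR.radius k T l ρ ε δ₀) (hrγ : r ≤ γ) :
    ∃ G : Set (IPTR.kerAX A x), MeasurableSet G ∧
      1 - δ₀ ≤ (IPTR.uniformBall (IPTR.kerAX A x) r).real G ∧
      ∀ y₀ ∈ G,
        ‖IPTR.negCurvatureOutput A f x l r T y₀‖ = 1 ∧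
        IPTR.negCurvatureOutput A f x l r T y₀ ∈ IPTR.kerAX A x ∧
        inner ℝ (IPTR.negCurvatureOutput A f x l r T y₀)
          (IPTR.scaledHessian f x x (IPTR.negCurvatureOutput A f x l r T y₀)) ≤ -√ε / 4 := by
  have hq : 0 < √ε := Real.sqrt_pos.mpr hε
  set H := IPTR.compression (IPTR.kerAX A x) (IPTR.scaledHessian f x x) with hH
  have hsymm : H.toLinearMap.IsSymmetric :=
    IPTR.isSymmetric_compression_scaledHessian hhess.twiceDifferentiable hx
  obtain ⟨μ, hμ, hμeig⟩ :=
    IPTR.exists_hasEigenvalue_lt_of_minEigenvalueOn_lt (by linarith) hneg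
  obtain ⟨i₀, hi₀⟩ := hsymm.exists_eigenvalues_eq hk.symm hμeig
  set B := hsymm.eigenvectorBasis hk.symm with hBdef
  have hkpos : 0 < k := i₀.pos
  have : Nontrivial (IPTR.kerAX A x) := Module.nontrivial_of_finrank_pos (R := ℝ) (hk ▸ hkpos)
  have hkn : k ≤ n := by
    rw [hk]
    simpa using (IPTR.kerAX A x).finrank_le
  have hl0 := IPTR.nonneg_of_scaledGradientLipschitz hγ_pos hgrad hx
  have hHnorm : ∀ v, ‖H v‖ ≤ l * ‖v‖ := fun v =>
    (H.le_opNorm v).trans (by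
      gcongr
      exact IPTR.norm_compression_scaledHessian_le hγ_pos hl0 hgrad hx)
  have hBeig : ∀ i, H (B i) = hsymm.eigenvalues hk.symm i • B i := fun i =>
    hsymm.apply_eigenvectorBasis hk.symm i
  -- the most negative eigenvalue has absolute value at most `l`
  have hεl : √ε < l := by
    have h := hHnorm (B i₀)
    rw [hBeig, norm_smul, B.norm_eq_one, mul_one, mul_one, Real.norm_eq_abs] at h
    have hi : hsymm.eigenvalues hk.symm i₀ = μ := hi₀
    rw [hi] at h
    linarith [neg_le_abs μ]
  have hl : 0 < l := hq.trans hεl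
  have hk' : (0 : ℝ) < k := by exact_mod_cast hkpos
  have hpi := Real.pi_pos
  have hr0 : 0 < r := by
    rw [hr, IPTR.radius]
    positivity
  refine ⟨_, ?_, IPTR.one_sub_le_uniformBall B i₀ hr0 hδ_pos, ?_⟩
  · exact measurableSet_closedBall.inter
      (isClosed_le (by fun_prop) continuous_const).measurableSet.compl
  rintro y₀ ⟨hy1, hy2⟩
  set y := IPTR.kerIterate A f x l r y₀ with hy
  set β : ℝ := δ₀ * √(Real.pi / k) / 2 with hβ
  have hlow := IPTR.subdominant_growth_numSteps_le hkpos hkn hl hε hεl hδ_pos hδ_lt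
  have herr := IPTR.accumulated_error_le hkpos hkn hl hρ hε hεl hδ_pos hδ_lt
  rw [← hT] at hlow herr
  rw [← hr] at herr
  obtain ⟨hne, hray⟩ := IPTR.rayleigh_le_of_powerIteration B (H := l⁻¹ • H.toLinearMap)
    (hsymm.smul (by simp)) (lam := fun i => l⁻¹ * hsymm.eigenvalues hk.symm i)
    (fun i => by
      have := hBeig i
      rw [LinearMap.smul_apply, ContinuousLinearMap.coe_coe, this, smul_smul])
    (fun v => by
      rw [LinearMap.smul_apply, norm_smul, norm_inv, Real.norm_eq_abs, abs_of_pos hl,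
        inv_mul_le_iff₀ hl]
      exact hHnorm v)
    (s := √ε / l) (β := β) (r := r) (η := ρ * r / (2 * l)) (T := T) (i₀ := i₀) (y := y)
    (by positivity) ((div_lt_one hl).mpr hεl) (by positivity) hr0 (by positivity)
    (by
      have hi : hsymm.eigenvalues hk.symm i₀ = μ := hi₀
      rw [hi, ← neg_div, div_eq_inv_mul]
      gcongr)
    (fun t => IPTR.norm_kerIterate_succ_le hl hr0 hrγ hgrad hx y₀ t)
    (fun t => IPTR.norm_kerIterate_succ_sub_le hl hρ hr0 hrγ hγ_lt hhess hx y₀ t)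
    (by simpa using! hy1) (le_of_lt (by simpa using! hy2)) hlow herr
  set v := y T with hv
  have hvn : ‖v‖ ≠ 0 := norm_ne_zero_iff.mpr hne
  have hout : IPTR.negCurvatureOutput A f x l r T y₀ =
      ((‖v‖⁻¹ • v : IPTR.kerAX A x) : EuclideanSpace ℝ (Fin n)) := by
    rw [IPTR.negCurvatureOutput, ← IPTR.coe_kerIterate]
    rfl
  rw [hout]
  refine ⟨?_, Submodule.coe_mem _, ?_⟩
  · rw [← Submodule.coe_norm, norm_smul, norm_inv, norm_norm, inv_mul_cancel₀ hvn]
  · rw [← Submodule.inner_orthogonalProjectionOnto_eq_of_mem_left]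
    refine IPTR.inner_apply_normalized_le (H := H.toLinearMap) hne ?_
    rw [LinearMap.smul_apply, inner_smul_right, inv_mul_le_iff₀ hl] at hray
    refine hray.trans_eq ?_
    field_simp
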